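/- **Setup.** Let $d,T,r\ge 1$ be integers and $D,B\ge 0$ reals. For a nonempty compact convex set $\mathcal X\subset\mathbb R^d$ of Euclidean diameter at most $D$, let $\mathcal O(\mathcal X)$ be the set of pairs $(f,O)$, where $f:\mathcal X\to\mathbb R$ is convex and $O$ is a first order oracle which, for each query $x\in\mathcal X$, outputs a fresh random vector $\hat g(x)\in\mathbb R^d$ with $\mathbb E[\hat g(x)\mid x]\in\partial f(x)$ and $\mathbb E[\|\hat g(x)\|_2^2\mid x]\le B^2$ (mean square bounded oracles). Let $\mathcal O_0(\mathcal X)$ be the set of such pairs with the second condition replaced by $P(\|\hat g(x)\|_2^2\le B^2\mid x)=1$ (almost surely bounded oracles). An $r$-bit quantizer $Q=Q^{\tt d}\circ Q^{\tt e}$ consists of a randomized encoder $Q^{\tt e}:\mathbb R^d\to\{0,1\}^r$ and a randomized decoder $Q^{\tt d}:\{0,1\}^r\to\mathbb R^d$, which may share randomness; $QO$ is the oracle that outputs $Q(\hat g(x))$ for a query $x$, with independent randomness of $Q$ at each query. A $T$-iteration protocol $\pi$ on $\mathcal X$ is a (possibly randomized) algorithm that makes $T$ adaptive queries in $\mathcal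 X$ to $QO$ and outputs a point $x^*(\pi^{QO})\in\mathcal X$; its error is $\mathcal E(f,\pi^{QO})=\mathbb E[f(x^*(\pi^{QO}))-\min_{x\in\mathcal X}f(x)]$. Put $$\mathcal E_0^*(T,r)=\sup_{\mathcal X}\inf_{\pi}\inf_{Q}\sup_{(f,O)\in\mathcal O_0(\mathcal X)}\mathcal E(f,\pi^{QO}),\qquad \mathcal E^*(T,r)=\sup_{\mathcal X}\inf_{\pi}\inf_{Q}\sup_{(f,O)\in\mathcal O(\mathcal X)}\mathcal E(f,\pi^{QO}),$$ with $\mathcal X$ ranging over all nonempty compact convex subsets of $\mathbb R^d$ of diameter at most $D$, $\pi$ over all $T$-iteration protocols on $\mathcal X$ and $Q$ over all $r$-bit quantizers. **Theorem.** There is an absolute constant $c>0$ (independent of $d,T,r,D,B$) such that, whenever $T\cdot\min\{d,r\}\ge d$, $$\mathcal E^*(T,r)\ \ge\ \mathcal E_0^*(T,r)\ \ge\ \frac{cDB}{\sqrt T}\cdot\sqrt{\frac{d}{\min\{d,r\}}},$$ while $\mathcal E^*(T,r)\ge\mathcal E_0^*(T,r)\ge cDB$ whenever $T\cdot\min\{d,r\}<d$.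 Consequently, precision $\Omega(d)$ is needed for the $1/\sqrt T$ rate: for every $K>0$ there are $\kappa>0$ and $T_0$, depending only on $K$, such that for all $d,r\ge1$, $D,B\ge0$ and $T\ge \max\{1,T_0\}$, if $\mathcal E_0^*(T,r)<KDB/\sqrt T$ or $\mathcal E^*(T,r)<KDB/\sqrt T$, then $r\ge\kappa d$. -/

import Mathlib

open MeasureTheory ProbabilityTheory Set
open scoped ENNReal

noncomputable section

namespace QuantOpt

/-- `ℝ^d` with the Euclidean norm. -/
abbrev Vec (d : ℕ) : Type := EuclideanSpace ℝ (Fin d)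

/-- The admissible domains: nonempty compact convex subsets of `ℝ^d` of Euclidean diameter at
most `D`. -/
def domains (d : ℕ) (D : ℝ) : Set (Set (Vec d)) :=
  {X | X.Nonempty ∧ IsCompact X ∧ Convex ℝ X ∧ ∀ x ∈ X, ∀ y ∈ X, ‖x - y‖ ≤ D}

/-- The set of subgradients at `x` of the function `f` on the domain `X`. -/
def subdiff {d : ℕ} (X : Set (Vec d)) (f : Vec d → ℝ) (x : Vec d) : Set (Vec d) :=
  {g | ∀ y ∈ X, f x + inner ℝ g (y - x) ≤ f y}

/-- A first order oracle on `X`: for a query `x ∈ X`, the probability measure `O x` is the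
conditional law of the (fresh) output given the query. -/
abbrev Oracle {d : ℕ} (X : Set (Vec d)) : Type := Kernel X (Vec d)

/-- Convex `f` on `X`, with an oracle whose output is integrable and has a subgradient of `f`
at the query point as its mean. -/
def IsUnbiasedOracle {d : ℕ} (X : Set (Vec d)) (f : Vec d → ℝ) (O : Oracle X) : Prop :=
  ConvexOn ℝ X f ∧ IsMarkovKernel O ∧
    ∀ x : X, Integrable (fun g : Vec d => g) (O x) ∧ (∫ g, g ∂(O x)) ∈ subdiff X f x

/-- Pairs of a convex function on `X` and a mean square bounded oracle for it. -/
def msOracles {d : ℕ} (X : Set (Vec d)) (B : ℝ) : Set ((Vec d → ℝ) × Oracle X) :=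
  {p | IsUnbiasedOracle X p.1 p.2 ∧
    ∀ x : X, ∫⁻ g, ENNReal.ofReal (‖g‖ ^ 2) ∂(p.2 x) ≤ ENNReal.ofReal (B ^ 2)}

/-- Pairs of a convex function on `X` and an almost surely bounded oracle for it. -/
def asOracles {d : ℕ} (X : Set (Vec d)) (B : ℝ) : Set ((Vec d → ℝ) × Oracle X) :=
  {p | IsUnbiasedOracle X p.1 p.2 ∧ ∀ x : X, ∀ᵐ g ∂(p.2 x), ‖g‖ ^ 2 ≤ B ^ 2}

/-- A randomized `r`-bit quantizer on `ℝ^d`: an encoder `ℝ^d → {0,1}^r` and a decoder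
`{0,1}^r → ℝ^d`, both driven by a random seed. Encoder and decoder may share (parts of) the seed,
or use independent parts of it. -/
structure Quantizer (d r : ℕ) where
  Seed : Type
  [instMeas : MeasurableSpace Seed]
  seedLaw : Measure Seed
  [instProb : IsProbabilityMeasure seedLaw]
  enc : Seed × Vec d → (Fin r → Bool)
  dec : Seed × (Fin r → Bool) → Vec d
  measurable_enc : Measurable enc
  measurable_dec : Measurable dec

attribute [instance] Quantizer.instMeas Quantizer.instProb

/-- Decoding after encoding, with the seed as first argument. -/
def Quantizer.apply {d r : ℕ} (Q : Quantizer d r) (p : Q.Seed × Vec d) : Vec d :=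
  Q.dec (p.1, Q.enc p)

/-- The composition oracle `QO`: its output at the query `x` is the quantized value of an oracle
output at `x`, with a seed of the quantizer that is drawn independently. -/
def Quantizer.compose {d r : ℕ} (Q : Quantizer d r) {X : Set (Vec d)} (O : Oracle X) : Oracle X :=
  ((Kernel.const X Q.seedLaw) ×ₖ O).map Q.apply

/-- A (possibly randomized, adaptive) optimization protocol on `X` with `T` iterations: query
number `t` depends on the seed and the first `t` replies (only queries `0, …, T - 1` are ever
made), and the output depends on the seed and all `T` replies. -/
structure Protocol {d : ℕ} (X : Set (Vec d)) (T : ℕ) where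
  Seed : Type
  [instMeas : MeasurableSpace Seed]
  seedLaw : Measure Seed
  [instProb : IsProbabilityMeasure seedLaw]
  query : (t : ℕ) → Seed × (Fin t → Vec d) → X
  output : Seed × (Fin T → Vec d) → X
  measurable_query : ∀ t, Measurable (query t)
  measurable_output : Measurable output

attribute [instance] Protocol.instMeas Protocol.instProb

/-- The joint law of the seed of the protocol and of the first `t` replies, when the protocol is
run with the oracle `O`. -/
def Protocol.law {d : ℕ} {X : Set (Vec d)} {T : ℕ} (π : Protocol X T) (O : Oracle X) :
    (t : ℕ) → Measure (π.Seed × (Fin t → Vec d))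
  | 0 => π.seedLaw.map (fun ω => (ω, Fin.elim0))
  | t + 1 =>
      ((π.law O t) ⊗ₘ (O.comap (π.query t) (π.measurable_query t))).map
        (fun p => (p.1.1, Fin.snoc (α := fun _ => Vec d) p.1.2 p.2))

/-- The expected error `E[f(x^*) - min_X f]` of the protocol run with the oracle `O`. -/
def Protocol.error {d : ℕ} {X : Set (Vec d)} {T : ℕ} (π : Protocol X T) (f : Vec d → ℝ)
    (O : Oracle X) : ℝ≥0∞ :=
  ∫⁻ p, ENNReal.ofReal (f (π.output p) - ⨅ x : X, f x) ∂(π.law O T)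

/-- The minmax error for almost surely bounded oracles. -/
def minmaxErrorAS (d T r : ℕ) (D B : ℝ) : ℝ≥0∞ :=
  ⨆ X ∈ domains d D, ⨅ π : Protocol X T, ⨅ Q : Quantizer d r,
    ⨆ p ∈ asOracles X B, π.error p.1 (Q.compose p.2)

/-- The minmax error for mean square bounded oracles. -/
def minmaxErrorMS (d T r : ℕ) (D B : ℝ) : ℝ≥0∞ :=
  ⨆ X ∈ domains d D, ⨅ π : Protocol X T, ⨅ Q : Quantizer d r,
    ⨆ p ∈ msOracles X B, π.error p.1 (Q.compose p.2)

end QuantOpt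

end

noncomputable section

namespace QuantOpt

/-! The hard problems are linear functions on a cube, indexed by sign vectors `v`. Their gradient is
constant, so an oracle may ignore the query and return i.i.d. scaled sign vectors `g` with `E[g i] =
ε * v i`. Adaptivity then gains nothing (`Protocol.law_const`), and once all seeds are fixed the
protocol is a deterministic function of `T` messages of `r` bits. Its error is governed by the
correlation of its output with `v`, and the worst case over `v` is at least the average.

For uniform `v`, correlation in coordinate `i` requires telling `v` from `flip v i`, which the
Hellinger distance between the two transcript laws controls; for independent messages this distance
is subadditive. The core is `sum_hell_msg_flip_le`: one message contributes at most `64 * ε ^ 2 *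
min d r`, summed over `i`. The factor `d` comes from bounded likelihood ratios. The factor `r` comes
from `sum_sq_msg_flip_sub_le`: the vector of scores is subgaussian, so conditioning on an event of
probability `p` moves its mean by a squared length of order `ε ^ 2 * log (1 / p)`, and averaging
over messages gives their entropy, at most `r * log 2`. Cauchy–Schwarz yields `sum_correlation_le`,
and `ε` of order `√(d / (T * min d r))`, capped at a constant, balances signal against
detectability. -/

lemma exp_le_add_exp_sq (x : ℝ) : Real.exp x ≤ x + Real.exp (x ^ 2) := by
  have h2 := Real.add_one_le_exp (x ^ 2)
  rcases le_or_gt |x| 1 with h | h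
  · have h1 := (abs_le.1 (Real.abs_exp_sub_one_sub_id_le h)).2
    linarith
  · rcases lt_or_ge 0 x with hx | hx
    · rw [abs_of_pos hx] at h
      have : Real.exp x ≤ Real.exp (x ^ 2) := Real.exp_le_exp.2 (by nlinarith)
      linarith
    · rw [abs_of_nonpos hx] at h
      have : Real.exp x ≤ 1 := Real.exp_le_one_iff.2 hx
      nlinarith

lemma one_sub_sum_le_prod_one_sub {ι : Type*} (s : Finset ι) (a : ι → ℝ)
    (h0 : ∀ i, 0 ≤ a i) (h1 : ∀ i, a i ≤ 1) : 1 - ∑ i ∈ s, a i ≤ ∏ i ∈ s, (1 - a i) := by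
  classical
  induction s using Finset.induction_on with
  | empty => simp
  | insert i s hi ih =>
    rw [Finset.sum_insert hi, Finset.prod_insert hi]
    have hs : 0 ≤ ∑ i ∈ s, a i := Finset.sum_nonneg fun j _ => h0 j
    have := mul_le_mul_of_nonneg_left ih (sub_nonneg.2 (h1 i))
    nlinarith [h0 i, mul_nonneg (h0 i) hs]

/-! ### Hellinger distance and entropy on finite types -/

/-- Squared Hellinger distance (unnormalized) of two functions on a finite type. -/
def hell {M : Type*} [Fintype M] (p q : M → ℝ) : ℝ := ∑ m, (√(p m) - √(q m)) ^ 2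

lemma hell_nonneg {M : Type*} [Fintype M] (p q : M → ℝ) : 0 ≤ hell p q :=
  Finset.sum_nonneg fun _ _ => sq_nonneg _

lemma hell_eq {M : Type*} [Fintype M] {p q : M → ℝ} (hp : ∀ m, 0 ≤ p m) (hq : ∀ m, 0 ≤ q m)
    (hp1 : ∑ m, p m = 1) (hq1 : ∑ m, q m = 1) :
    hell p q = 2 - 2 * ∑ m, √(p m) * √(q m) := by
  have : ∀ m, (√(p m) - √(q m)) ^ 2 = p m + q m - 2 * (√(p m) * √(q m)) := fun m => by
    rw [sub_sq, Real.sq_sqrt (hp m), Real.sq_sqrt (hq m)]; ring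
  simp only [hell, this, Finset.sum_sub_distrib, Finset.sum_add_distrib, hp1, hq1,
    ← Finset.mul_sum]
  norm_num

/-- Total variation is bounded by the Hellinger distance. -/
lemma abs_sum_sub_mul_le {M : Type*} [Fintype M] {p q F : M → ℝ} {a : ℝ} (hp : ∀ m, 0 ≤ p m)
    (hq : ∀ m, 0 ≤ q m) (hp1 : ∑ m, p m = 1) (hq1 : ∑ m, q m = 1) (hF : ∀ m, |F m| ≤ a)
    (ha : 0 ≤ a) : |∑ m, (p m - q m) * F m| ≤ 2 * a * √(hell p q) := by
  have e : ∀ m, |(p m - q m) * F m| ≤ a * (|√(p m) - √(q m)| * (√(p m) + √(q m))) := fun m => by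
    have : p m - q m = (√(p m) - √(q m)) * (√(p m) + √(q m)) := by
      nlinarith [Real.sq_sqrt (hp m), Real.sq_sqrt (hq m)]
    rw [abs_mul, this, abs_mul, abs_of_nonneg (a := √(p m) + √(q m)) (by positivity), mul_comm]
    exact mul_le_mul_of_nonneg_right (hF m) (by positivity)
  have cs := Real.sum_mul_le_sqrt_mul_sqrt Finset.univ (fun m => |√(p m) - √(q m)|)
    (fun m => √(p m) + √(q m))
  have h4 : ∑ m, (√(p m) + √(q m)) ^ 2 ≤ 4 := by
    calc _ ≤ ∑ m, (2 * p m + 2 * q m) := Finset.sum_le_sum fun m _ => by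
          nlinarith [Real.sq_sqrt (hp m), Real.sq_sqrt (hq m), sq_nonneg (√(p m) - √(q m))]
      _ = 4 := by rw [Finset.sum_add_distrib, ← Finset.mul_sum, ← Finset.mul_sum, hp1, hq1]
                  norm_num
  have h4' : √(∑ m, (√(p m) + √(q m)) ^ 2) ≤ 2 := by
    rw [show (2 : ℝ) = √4 by rw [show (4 : ℝ) = 2 ^ 2 by norm_num]; simp]
    exact Real.sqrt_le_sqrt h4
  simp only [sq_abs] at cs
  calc |∑ m, (p m - q m) * F m| ≤ ∑ m, |(p m - q m) * F m| := Finset.abs_sum_le_sum_abs _ _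
    _ ≤ ∑ m, a * (|√(p m) - √(q m)| * (√(p m) + √(q m))) := Finset.sum_le_sum fun m _ => e m
    _ = a * ∑ m, |√(p m) - √(q m)| * (√(p m) + √(q m)) := by rw [Finset.mul_sum]
    _ ≤ a * (√(hell p q) * 2) := by
      refine mul_le_mul_of_nonneg_left (cs.trans ?_) ha
      exact mul_le_mul_of_nonneg_left h4' (Real.sqrt_nonneg _)
    _ = _ := by ring

/-- Subadditivity of the squared Hellinger distance for product distributions. -/
lemma hell_prod_le {ι M : Type*} [Fintype ι] [DecidableEq ι] [Fintype M] {p q : ι → M → ℝ}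
    (hp : ∀ t m, 0 ≤ p t m) (hq : ∀ t m, 0 ≤ q t m) (hp1 : ∀ t, ∑ m, p t m = 1)
    (hq1 : ∀ t, ∑ m, q t m = 1) :
    hell (fun x : ι → M => ∏ t, p t (x t)) (fun x => ∏ t, q t (x t)) ≤ ∑ t, hell (p t) (q t) := by
  have hP1 : ∑ x : ι → M, ∏ t, p t (x t) = 1 := by
    rw [← Fintype.prod_sum]; simp [hp1]
  have hQ1 : ∑ x : ι → M, ∏ t, q t (x t) = 1 := by
    rw [← Fintype.prod_sum]; simp [hq1]
  rw [hell_eq (fun x => Finset.prod_nonneg fun t _ => hp t _)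
    (fun x => Finset.prod_nonneg fun t _ => hq t _) hP1 hQ1]
  -- The affinity `∑ √p * √q = 1 - hell p q / 2` is multiplicative over products.
  have e : ∑ x : ι → M, √(∏ t, p t (x t)) * √(∏ t, q t (x t))
      = ∏ t, (1 - hell (p t) (q t) / 2) := by
    have : ∀ t, 1 - hell (p t) (q t) / 2 = ∑ m, √(p t m) * √(q t m) := fun t => by
      rw [hell_eq (hp t) (hq t) (hp1 t) (hq1 t)]; ring
    simp_rw [this]
    rw [Fintype.prod_sum]
    refine Finset.sum_congr rfl fun x _ => ?_
    rw [Finset.prod_mul_distrib, Real.sqrt_prod _ fun t _ => hp t _,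
      Real.sqrt_prod _ fun t _ => hq t _]
  rw [e]
  have := one_sub_sum_le_prod_one_sub Finset.univ (fun t => hell (p t) (q t) / 2)
    (fun t => by have := hell_nonneg (p t) (q t); positivity) (fun t => by
      rw [hell_eq (hp t) (hq t) (hp1 t) (hq1 t)]
      have : 0 ≤ ∑ m, √(p t m) * √(q t m) := Finset.sum_nonneg fun m _ => by positivity
      linarith)
  rw [← Finset.sum_div] at this
  linarith

/-- Termwise comparison of Hellinger with chi-square. Absolute continuity `h` is needed because
division by zero makes the right side vanish at `p = 0`. -/
lemma sq_sqrt_sub_sqrt_le {p q : ℝ} (hp : 0 ≤ p) (hq : 0 ≤ q) (h : p = 0 → q = 0) :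
    (√p - √q) ^ 2 ≤ (q - p) ^ 2 / p := by
  rcases hp.eq_or_lt with h0 | h0
  · rw [← h0, h h0.symm]; simp
  · rw [le_div_iff₀ h0]
    have e : q - p = (√q - √p) * (√q + √p) := by
      nlinarith [Real.sq_sqrt hp, Real.sq_sqrt hq]
    rw [e, mul_pow, ← neg_sub, neg_sq]
    refine mul_le_mul_of_nonneg_left ?_ (sq_nonneg _)
    nlinarith [Real.sq_sqrt hp, Real.sqrt_nonneg p, Real.sqrt_nonneg q]

/-- The entropy of a distribution on `M` is at most `log (card M)`. -/
lemma sum_negMulLog_le {M : Type*} [Fintype M] [Nonempty M] {p : M → ℝ} (hp : ∀ m, 0 ≤ p m)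
    (hp1 : ∑ m, p m = 1) :
    ∑ m, Real.negMulLog (p m) ≤ Real.log (Fintype.card M : ℝ) := by
  have hN : (0 : ℝ) < Fintype.card M := by exact_mod_cast Fintype.card_pos
  set N : ℝ := (Fintype.card M : ℝ) with hNdef
  -- This is `log x ≤ x - 1` at `x = 1 / (p m * N)`; the corrections `1 / N - p m` sum to zero.
  have : ∀ m, Real.negMulLog (p m) ≤ p m * Real.log N + (1 / N - p m) := fun m => by
    rcases (hp m).eq_or_lt with h0 | h0
    · rw [← h0]; simp [hN.le]
    · have h := Real.log_le_sub_one_of_pos (x := 1 / (p m * N)) (by positivity)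
      rw [Real.log_div one_ne_zero (by positivity), Real.log_mul h0.ne' hN.ne', Real.log_one] at h
      have := mul_le_mul_of_nonneg_left h h0.le
      have e : p m * (1 / (p m * N) - 1) = 1 / N - p m := by field_simp
      rw [e] at this
      rw [Real.negMulLog]; linarith
  calc _ ≤ ∑ m, (p m * Real.log N + (1 / N - p m)) := Finset.sum_le_sum fun m _ => this m
    _ = Real.log N := by
      rw [Finset.sum_add_distrib, Finset.sum_sub_distrib, ← Finset.sum_mul, hp1]
      simp [← hNdef, hN.ne']

/-- The sign `±1` of a bit. -/
def sgn (b : Bool) : ℝ := cond b 1 (-1)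

lemma sgn_not (b : Bool) : sgn (!b) = -sgn b := by cases b <;> simp [sgn]

lemma sgn_mul_self (b : Bool) : sgn b * sgn b = 1 := by cases b <;> simp [sgn]

lemma abs_sgn (b : Bool) : |sgn b| = 1 := by cases b <;> simp [sgn]

/-! ### Information about the signs carried by short messages -/

section SignMessages

variable {d : ℕ}

/-- The probability of `g` under independent signs with `E[g i] = ε * v i`. -/
def wt (ε : ℝ) (v g : Fin d → Bool) : ℝ := ∏ i, (1 + ε * (sgn (v i) * sgn (g i))) / 2

/-- Flip one bit. -/
def flip (v : Fin d → Bool) (i : Fin d) : Fin d → Bool := Function.update v i (!v i)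

lemma flip_flip (v : Fin d → Bool) (i : Fin d) : flip (flip v i) i = v := by
  simp [flip]

lemma flip_self (v : Fin d → Bool) (i : Fin d) : flip v i i = !v i := by
  simp [flip]

/-- The likelihood ratio minus one of a coordinate whose bias is flipped. -/
def phi (ε : ℝ) (b c : Bool) : ℝ := -(2 * ε * (sgn b * sgn c)) / (1 + ε * (sgn b * sgn c))

lemma one_add_pos {ε : ℝ} (h0 : 0 ≤ ε) (h1 : ε ≤ 1 / 2) (b c : Bool) :
    0 < 1 + ε * (sgn b * sgn c) := by
  cases b <;> cases c <;> simp [sgn] <;> linarith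

lemma wt_pos {ε : ℝ} (h0 : 0 ≤ ε) (h1 : ε ≤ 1 / 2) (v g : Fin d → Bool) : 0 < wt ε v g :=
  Finset.prod_pos fun _ _ => div_pos (one_add_pos h0 h1 _ _) two_pos

lemma sum_wt_mul_prod (ε : ℝ) (v : Fin d → Bool) (F : Fin d → Bool → ℝ) :
    ∑ g, wt ε v g * ∏ i, F i (g i)
      = ∏ i, ∑ c, (1 + ε * (sgn (v i) * sgn c)) / 2 * F i c := by
  rw [Fintype.prod_sum]
  refine Finset.sum_congr rfl fun g _ => ?_
  rw [wt, Finset.prod_mul_distrib]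

lemma sum_wt (ε : ℝ) (v : Fin d → Bool) : ∑ g, wt ε v g = 1 := by
  have := sum_wt_mul_prod ε v fun _ _ => 1
  simp only [Finset.prod_const_one, mul_one] at this
  rw [this]
  refine Finset.prod_eq_one fun i _ => ?_
  cases v i <;> simp [sgn] <;> ring

lemma wt_flip {ε : ℝ} (h0 : 0 ≤ ε) (h1 : ε ≤ 1 / 2) (v g : Fin d → Bool) (i : Fin d) :
    wt ε (flip v i) g = wt ε v g * (1 + phi ε (v i) (g i)) := by
  rw [wt, wt, ← Finset.mul_prod_erase _ _ (Finset.mem_univ i),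
    ← Finset.mul_prod_erase (a := i) _ _ (Finset.mem_univ i), flip_self, sgn_not]
  have : ∏ x ∈ Finset.univ.erase i, (1 + ε * (sgn (flip v i x) * sgn (g x))) / 2
      = ∏ x ∈ Finset.univ.erase i, (1 + ε * (sgn (v x) * sgn (g x))) / 2 :=
    Finset.prod_congr rfl fun x hx => by
      rw [flip, Function.update_of_ne (Finset.ne_of_mem_erase hx)]
  rw [this, phi]
  have hne := (one_add_pos h0 h1 (v i) (g i)).ne'
  have e : 1 + -(2 * ε * (sgn (v i) * sgn (g i))) / (1 + ε * (sgn (v i) * sgn (g i)))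
      = (1 + ε * (-sgn (v i) * sgn (g i))) / (1 + ε * (sgn (v i) * sgn (g i))) := by
    rw [eq_div_iff hne, add_mul, div_mul_cancel₀ _ hne]; ring
  rw [e, mul_right_comm, div_mul_div_comm, mul_comm 2, mul_div_mul_left _ _ hne]

lemma abs_phi_le {ε : ℝ} (h0 : 0 ≤ ε) (h1 : ε ≤ 1 / 2) (b c : Bool) : |phi ε b c| ≤ 4 * ε := by
  have h := one_add_pos h0 h1 b c
  rw [phi, abs_div, abs_neg, abs_mul, abs_mul (sgn b), abs_sgn, abs_sgn, abs_of_pos h,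
    div_le_iff₀ h, abs_of_nonneg (by positivity)]
  cases b <;> cases c <;> simp [sgn] <;> nlinarith

/-- Subgaussianity of the scores `phi`. By independence the sum factors over coordinates; each score
has mean zero and size at most `4 * ε`, so the linear term of `exp_le_add_exp_sq` averages out. -/
lemma sum_wt_mul_exp_le {ε : ℝ} (h0 : 0 ≤ ε) (h1 : ε ≤ 1 / 2) (v : Fin d → Bool)
    (l : Fin d → ℝ) :
    ∑ g, wt ε v g * Real.exp (∑ i, l i * phi ε (v i) (g i))
      ≤ Real.exp (16 * ε ^ 2 * ∑ i, l i ^ 2) := by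
  simp_rw [Real.exp_sum]
  rw [sum_wt_mul_prod ε v fun i c => Real.exp (l i * phi ε (v i) c), Finset.mul_sum,
    Real.exp_sum]
  refine Finset.prod_le_prod (fun i _ => Finset.sum_nonneg fun c _ => ?_) fun i _ => ?_
  · have := one_add_pos h0 h1 (v i) c
    positivity
  have hw : ∑ c, (1 + ε * (sgn (v i) * sgn c)) / 2 = 1 := by
    cases v i <;> simp [sgn] <;> ring
  have hm : ∑ c, (1 + ε * (sgn (v i) * sgn c)) / 2 * (l i * phi ε (v i) c) = 0 := by
    have e : ∀ c, (1 + ε * (sgn (v i) * sgn c)) / 2 * (l i * phi ε (v i) c)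
        = - l i * ε * sgn (v i) * sgn c := fun c => by
      have := (one_add_pos h0 h1 (v i) c).ne'
      rw [phi, mul_div_assoc', div_mul_div_comm, div_eq_iff (by positivity)]; ring
    simp_rw [e]
    simp [sgn]
  calc _ ≤ ∑ c, (1 + ε * (sgn (v i) * sgn c)) / 2 *
        (l i * phi ε (v i) c + Real.exp (16 * ε ^ 2 * l i ^ 2)) := by
        refine Finset.sum_le_sum fun c _ => mul_le_mul_of_nonneg_left ?_ ?_
        · refine (exp_le_add_exp_sq _).trans (add_le_add_right (Real.exp_le_exp.2 ?_) _)
          have := sq_le_sq.2 ((abs_phi_le h0 h1 (v i) c).trans (le_abs_self _))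
          nlinarith [sq_nonneg (l i)]
        · have := one_add_pos h0 h1 (v i) c
          positivity
    _ = _ := by simp_rw [mul_add, Finset.sum_add_distrib, ← Finset.sum_mul]; rw [hw, hm]; ring

variable {M : Type*} [DecidableEq M]

/-- The law of the message `e g` for a random `g`. -/
def msg (ε : ℝ) (e : (Fin d → Bool) → M) (v : Fin d → Bool) (m : M) : ℝ :=
  ∑ g, if e g = m then wt ε v g else 0

lemma msg_nonneg {ε : ℝ} (h0 : 0 ≤ ε) (h1 : ε ≤ 1 / 2) (e : (Fin d → Bool) → M)
    (v : Fin d → Bool) (m : M) : 0 ≤ msg ε e v m :=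
  Finset.sum_nonneg fun g _ => by
    split_ifs
    · exact (wt_pos h0 h1 v g).le
    · rfl

lemma sum_msg [Fintype M] (ε : ℝ) (e : (Fin d → Bool) → M) (v : Fin d → Bool) : ∑ m, msg ε e v m = 1 := by
  simp only [msg]
  rw [Finset.sum_comm]
  simp [sum_wt]

lemma msg_flip_sub {ε : ℝ} (h0 : 0 ≤ ε) (h1 : ε ≤ 1 / 2) (e : (Fin d → Bool) → M)
    (v : Fin d → Bool) (i : Fin d) (m : M) :
    msg ε e (flip v i) m - msg ε e v m
      = ∑ g, if e g = m then wt ε v g * phi ε (v i) (g i) else 0 := by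
  rw [msg, msg, ← Finset.sum_sub_distrib]
  refine Finset.sum_congr rfl fun g _ => ?_
  split_ifs
  · rw [wt_flip h0 h1]; ring
  · simp

/-- The bound on the likelihood ratio survives any encoding. It supplies both the absolute
continuity for the chi-square comparison and the `d` branch of `sum_hell_msg_flip_le`. -/
lemma abs_msg_flip_sub_le {ε : ℝ} (h0 : 0 ≤ ε) (h1 : ε ≤ 1 / 2) (e : (Fin d → Bool) → M)
    (v : Fin d → Bool) (i : Fin d) (m : M) :
    |msg ε e (flip v i) m - msg ε e v m| ≤ 4 * ε * msg ε e v m := by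
  rw [msg_flip_sub h0 h1, msg, Finset.mul_sum]
  refine (Finset.abs_sum_le_sum_abs _ _).trans (Finset.sum_le_sum fun g _ => ?_)
  split_ifs
  · rw [abs_mul, abs_of_pos (wt_pos h0 h1 v g), mul_comm]
    exact mul_le_mul_of_nonneg_right (abs_phi_le h0 h1 _ _) (wt_pos h0 h1 v g).le
  · simp

/-- Information bound from subgaussianity: the posterior mean of the score given the message `m`
is of order at most the square root of the log of the inverse probability of `m`. -/
lemma sum_sq_msg_flip_sub_le {ε : ℝ} (h0 : 0 < ε) (h1 : ε ≤ 1 / 2) (e : (Fin d → Bool) → M)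
    (v : Fin d → Bool) (m : M) :
    ∑ i, (msg ε e (flip v i) m - msg ε e v m) ^ 2 / msg ε e v m
      ≤ 64 * ε ^ 2 * Real.negMulLog (msg ε e v m) := by
  rcases (msg_nonneg h0.le h1 e v m).eq_or_lt with hp | hp
  · rw [← hp]; simp
  set p := msg ε e v m with hpdef
  set a : Fin d → ℝ := fun i => msg ε e (flip v i) m - p with ha
  -- The tilt `l` points along the shift `a`; this `s` maximizes `s - 16 * ε ^ 2 * s ^ 2`, with
  -- value `1 / (64 * ε ^ 2)`.
  set s : ℝ := 1 / (32 * ε ^ 2) with hs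
  set l : Fin d → ℝ := fun i => s * a i / p with hl
  set y : (Fin d → Bool) → ℝ := fun g => ∑ i, l i * phi ε (v i) (g i) with hy
  set c : ℝ := 16 * ε ^ 2 * ∑ i, l i ^ 2 - Real.log p with hc
  -- Gibbs variational bound by hand: `1 + x ≤ exp x` on the event `e g = m`, then the exponential
  -- is summed over all `g`. The shift `c` is chosen so that the total is exactly `p`.
  have k1 : ∑ g, (if e g = m then wt ε v g * (1 + y g - c) else 0) ≤ p := by
    calc _ ≤ ∑ g, wt ε v g * Real.exp (y g) * Real.exp (-c) := by
          refine Finset.sum_le_sum fun g _ => ?_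
          have hw := wt_pos h0.le h1 v g
          split_ifs
          · rw [mul_assoc, ← Real.exp_add]
            refine mul_le_mul_of_nonneg_left ?_ hw.le
            have := Real.add_one_le_exp (y g + -c)
            linarith
          · positivity
      _ = (∑ g, wt ε v g * Real.exp (y g)) * Real.exp (-c) := by rw [Finset.sum_mul]
      _ ≤ Real.exp (16 * ε ^ 2 * ∑ i, l i ^ 2) * Real.exp (-c) :=
          mul_le_mul_of_nonneg_right (sum_wt_mul_exp_le h0.le h1 v l) (Real.exp_pos _).le
      _ = p := by rw [← Real.exp_add, hc]; simp [Real.exp_log hp]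
  have k2 : ∑ g, (if e g = m then wt ε v g * (1 + y g - c) else 0)
      = p * (1 - c) + ∑ i, l i * a i := by
    have e1 : ∀ i, l i * a i = ∑ g, if e g = m then wt ε v g * (l i * phi ε (v i) (g i)) else 0 :=
      fun i => by
        rw [ha]
        simp only [hpdef]
        rw [msg_flip_sub h0.le h1, Finset.mul_sum]
        refine Finset.sum_congr rfl fun g _ => ?_
        split_ifs <;> ring
    simp_rw [e1]
    rw [Finset.sum_comm, hpdef, msg, Finset.sum_mul, ← Finset.sum_add_distrib]
    refine Finset.sum_congr rfl fun g _ => ?_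
    split_ifs
    · rw [← Finset.mul_sum, ← mul_add]; congr 1; rw [hy]; ring
    · simp
  rw [k2] at k1
  set A := ∑ i, a i ^ 2 with hA
  have e2 : ∑ i, l i * a i = s * A / p := by
    rw [hA, Finset.mul_sum, Finset.sum_div]
    exact Finset.sum_congr rfl fun i _ => by rw [hl]; ring
  have e3 : ∑ i, l i ^ 2 = s ^ 2 * A / p ^ 2 := by
    rw [hA, Finset.mul_sum, Finset.sum_div]
    exact Finset.sum_congr rfl fun i _ => by rw [hl]; ring
  rw [e2] at k1
  rw [e3] at hc
  have e4 : s * A / p - p * (16 * ε ^ 2 * (s ^ 2 * A / p ^ 2)) = A / p / (64 * ε ^ 2) := by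
    rw [hs]; field_simp; ring
  have e5 : A / p / (64 * ε ^ 2) ≤ Real.negMulLog p := by
    rw [← e4, Real.negMulLog]
    rw [hc] at k1
    linarith
  rw [div_le_iff₀ (by positivity)] at e5
  rw [← Finset.sum_div]
  linarith

/-- Two separate bounds through chi-square. Each coordinate contributes at most `16 * ε ^ 2`, which
gives `d`; summing over coordinates first gives the message entropy, at most `r * log 2 ≤ r`. -/
lemma sum_hell_msg_flip_le {r : ℕ} {ε : ℝ} (h0 : 0 < ε) (h1 : ε ≤ 1 / 2)
    (e : (Fin d → Bool) → (Fin r → Bool)) (v : Fin d → Bool) :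
    ∑ i, hell (msg ε e v) (msg ε e (flip v i)) ≤ 64 * ε ^ 2 * (min d r : ℕ) := by
  have hb : ∀ i m, (√(msg ε e v m) - √(msg ε e (flip v i) m)) ^ 2
      ≤ (msg ε e (flip v i) m - msg ε e v m) ^ 2 / msg ε e v m := fun i m => by
    refine sq_sqrt_sub_sqrt_le (msg_nonneg h0.le h1 _ _ _) (msg_nonneg h0.le h1 _ _ _) fun h => ?_
    have := abs_msg_flip_sub_le h0.le h1 e v i m
    rw [h] at this
    simpa using this
  have hd : ∑ i, hell (msg ε e v) (msg ε e (flip v i)) ≤ 64 * ε ^ 2 * d := by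
    have : ∀ i, hell (msg ε e v) (msg ε e (flip v i)) ≤ 16 * ε ^ 2 := fun i => by
      calc _ ≤ ∑ m, 16 * ε ^ 2 * msg ε e v m := by
            refine Finset.sum_le_sum fun m _ => (hb i m).trans ?_
            have hp := msg_nonneg h0.le h1 e v m
            refine div_le_of_le_mul₀ hp (by positivity) ?_
            have := sq_le_sq.2 ((abs_msg_flip_sub_le h0.le h1 e v i m).trans (le_abs_self _))
            linarith
        _ = _ := by rw [← Finset.mul_sum, sum_msg, mul_one]
    refine (Finset.sum_le_sum fun i _ => this i).trans ?_
    rw [Finset.sum_const, Finset.card_univ, Fintype.card_fin, nsmul_eq_mul]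
    nlinarith [mul_nonneg (sq_nonneg ε) (Nat.cast_nonneg (α := ℝ) d)]
  have hr : ∑ i, hell (msg ε e v) (msg ε e (flip v i)) ≤ 64 * ε ^ 2 * r := by
    calc _ ≤ ∑ i, ∑ m, (msg ε e (flip v i) m - msg ε e v m) ^ 2 / msg ε e v m :=
          Finset.sum_le_sum fun i _ => Finset.sum_le_sum fun m _ => hb i m
      _ = ∑ m, ∑ i, (msg ε e (flip v i) m - msg ε e v m) ^ 2 / msg ε e v m := Finset.sum_comm
      _ ≤ ∑ m, 64 * ε ^ 2 * Real.negMulLog (msg ε e v m) :=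
          Finset.sum_le_sum fun m _ => sum_sq_msg_flip_sub_le h0 h1 e v m
      _ ≤ 64 * ε ^ 2 * r := by
          rw [← Finset.mul_sum]
          refine mul_le_mul_of_nonneg_left ?_ (by positivity)
          refine (sum_negMulLog_le (msg_nonneg h0.le h1 e v) (sum_msg ε e v)).trans ?_
          simp only [Fintype.card_pi, Fintype.card_bool, Finset.prod_const, Finset.card_univ,
            Fintype.card_fin, Nat.cast_pow, Nat.cast_ofNat, Real.log_pow]
          nlinarith [Real.log_two_lt_d9, Nat.cast_nonneg (α := ℝ) r]
  rcases min_choice d r with h | h <;> rw [h] <;> assumption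

/-- Summing over transcripts of vectors is summing over transcripts of messages. -/
lemma sum_prod_wt_mul [Fintype M] {T : ℕ} (ε : ℝ) (e : Fin T → (Fin d → Bool) → M) (v : Fin d → Bool)
    (F : (Fin T → M) → ℝ) :
    ∑ G : Fin T → (Fin d → Bool), (∏ t, wt ε v (G t)) * F (fun t => e t (G t))
      = ∑ x : Fin T → M, (∏ t, msg ε (e t) v (x t)) * F x := by
  have h : ∀ x : Fin T → M, (∏ t, msg ε (e t) v (x t)) * F x
      = ∑ G : Fin T → (Fin d → Bool),
        if (fun t => e t (G t)) = x then (∏ t, wt ε v (G t)) * F x else 0 := fun x => by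
    simp only [msg]
    rw [Fintype.prod_sum, Finset.sum_mul]
    refine Finset.sum_congr rfl fun G _ => ?_
    rw [Finset.prod_ite_zero]
    simp only [Finset.mem_univ, true_imp_iff, funext_iff]
    split_ifs <;> simp
  simp_rw [h]
  rw [Finset.sum_comm]
  simp

/-- The average correlation between the signs and the output of any procedure that sees `T`
messages of `r` bits. -/
lemma sum_correlation_le {T r : ℕ} {ε a : ℝ} (h0 : 0 < ε) (h1 : ε ≤ 1 / 2) (ha : 0 ≤ a)
    (e : Fin T → (Fin d → Bool) → (Fin r → Bool)) (F : (Fin T → (Fin r → Bool)) → Fin d → ℝ)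
    (hF : ∀ x i, |F x i| ≤ a) :
    ∑ v, ∑ x, (∏ t, msg ε (e t) v (x t)) * ∑ i, sgn (v i) * F x i
      ≤ 2 ^ d * (8 * a * ε * √(d * (T * (min d r : ℕ)))) := by
  set E : (Fin d → Bool) → Fin d → ℝ := fun v i => ∑ x, (∏ t, msg ε (e t) v (x t)) * F x i
  have s1 : ∀ v, ∑ x, (∏ t, msg ε (e t) v (x t)) * ∑ i, sgn (v i) * F x i
      = ∑ i, sgn (v i) * E v i := fun v => by
    simp only [E, Finset.mul_sum]
    rw [Finset.sum_comm]
    exact Finset.sum_congr rfl fun i _ => Finset.sum_congr rfl fun x _ => by ring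
  -- Reindexing by the involution `v ↦ flip v i` changes the sign of `sgn (v i)`, so each `v` is
  -- compared with its neighbour.
  have s2 : ∀ i, ∑ v, sgn (v i) * E v i = 1 / 2 * ∑ v, sgn (v i) * (E v i - E (flip v i) i) :=
    fun i => by
      have : ∑ v, sgn (v i) * E (flip v i) i = - ∑ v, sgn (v i) * E v i := by
        rw [← Finset.sum_neg_distrib]
        refine Fintype.sum_equiv ⟨fun v => flip v i, fun v => flip v i, fun v => flip_flip v i,
          fun v => flip_flip v i⟩ _ _ fun v => ?_
        simp [flip_self, sgn_not]
      simp_rw [mul_sub]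
      rw [Finset.sum_sub_distrib, this]
      ring
  have s3 : ∀ v i, sgn (v i) * (E v i - E (flip v i) i)
      ≤ 2 * a * √(∑ t, hell (msg ε (e t) v) (msg ε (e t) (flip v i))) := fun v i => by
    refine (le_abs_self _).trans ?_
    rw [abs_mul, abs_sgn, one_mul]
    simp only [E]
    rw [← Finset.sum_sub_distrib]
    simp_rw [← sub_mul]
    have hn := fun v t m => msg_nonneg h0.le h1 (e t) v m
    have hs := fun v t => sum_msg ε (e t) v
    refine (abs_sum_sub_mul_le (fun x => Finset.prod_nonneg fun t _ => hn _ _ _)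
      (fun x => Finset.prod_nonneg fun t _ => hn _ _ _) ?_ ?_ (fun x => hF x i) ha).trans ?_
    · rw [← Fintype.prod_sum]; simp [hs]
    · rw [← Fintype.prod_sum]; simp [hs]
    · refine mul_le_mul_of_nonneg_left (Real.sqrt_le_sqrt ?_) (by positivity)
      exact hell_prod_le (hn v) (hn (flip v i)) (hs v) (hs (flip v i))
  -- Cauchy–Schwarz over `i` costs `√d` and leaves the sum over coordinates inside the root, where
  -- `sum_hell_msg_flip_le` applies to each message.
  have s4 : ∀ v, ∑ i, √(∑ t, hell (msg ε (e t) v) (msg ε (e t) (flip v i)))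
      ≤ 8 * ε * √(d * (T * (min d r : ℕ))) := fun v => by
    have cs := Real.sum_mul_le_sqrt_mul_sqrt Finset.univ (fun _ : Fin d => (1 : ℝ))
      (fun i => √(∑ t, hell (msg ε (e t) v) (msg ε (e t) (flip v i))))
    have hn : ∀ i, 0 ≤ ∑ t, hell (msg ε (e t) v) (msg ε (e t) (flip v i)) :=
      fun i => Finset.sum_nonneg fun t _ => hell_nonneg _ _
    simp only [one_mul, one_pow, Real.sq_sqrt (hn _), Finset.sum_const, Finset.card_univ,
      Fintype.card_fin, nsmul_eq_mul, mul_one] at cs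
    refine cs.trans ?_
    rw [Finset.sum_comm, ← Real.sqrt_mul (Nat.cast_nonneg d),
      show 8 * ε = √((8 * ε) ^ 2) by rw [Real.sqrt_sq]; positivity,
      ← Real.sqrt_mul (sq_nonneg _)]
    refine Real.sqrt_le_sqrt ?_
    have : ∑ t, ∑ i, hell (msg ε (e t) v) (msg ε (e t) (flip v i))
        ≤ ∑ t : Fin T, 64 * ε ^ 2 * (min d r : ℕ) :=
      Finset.sum_le_sum fun t _ => sum_hell_msg_flip_le h0 h1 (e t) v
    rw [Finset.sum_const, Finset.card_univ, Fintype.card_fin, nsmul_eq_mul] at this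
    calc _ ≤ (d : ℝ) * (T * (64 * ε ^ 2 * (min d r : ℕ))) :=
          mul_le_mul_of_nonneg_left this (Nat.cast_nonneg d)
      _ = _ := by ring
  simp_rw [s1]
  rw [Finset.sum_comm]
  simp_rw [s2]
  rw [← Finset.mul_sum, Finset.sum_comm]
  calc 1 / 2 * ∑ v, ∑ i, sgn (v i) * (E v i - E (flip v i) i)
      ≤ 1 / 2 * ∑ v : Fin d → Bool, 2 * a * (8 * ε * √(d * (T * (min d r : ℕ)))) := by
        refine mul_le_mul_of_nonneg_left (Finset.sum_le_sum fun v _ => ?_) (by norm_num)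
        refine (Finset.sum_le_sum fun i _ => s3 v i).trans ?_
        rw [← Finset.mul_sum]
        exact mul_le_mul_of_nonneg_left (s4 v) (by positivity)
    _ = _ := by
      rw [Finset.sum_const, Finset.card_univ, Fintype.card_pi]
      simp only [Fintype.card_bool, Finset.prod_const, Finset.card_univ, Fintype.card_fin,
        nsmul_eq_mul]
      push_cast
      ring

end SignMessages

/-! ### Law of the replies of an oracle that ignores its queries -/

lemma measurable_snoc {α : Type*} [MeasurableSpace α] (t : ℕ) :
    Measurable fun p : (Fin t → α) × α => Fin.snoc (α := fun _ => α) p.1 p.2 := by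
  refine measurable_pi_lambda _ fun i => ?_
  refine Fin.lastCases ?_ (fun j => ?_) i
  · simpa using measurable_snd
  · simp only [Fin.snoc_castSucc]
    fun_prop

lemma map_snoc_pi_prod {α : Type*} [MeasurableSpace α] (N : Measure α) [IsProbabilityMeasure N]
    (t : ℕ) :
    ((Measure.pi fun _ : Fin t => N).prod N).map
      (fun p => Fin.snoc (α := fun _ => α) p.1 p.2) = Measure.pi fun _ : Fin (t + 1) => N := by
  symm
  refine Measure.pi_eq fun s hs => ?_
  rw [Measure.map_apply (measurable_snoc t) (MeasurableSet.univ_pi hs)]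
  have : (fun p : (Fin t → α) × α => Fin.snoc (α := fun _ => α) p.1 p.2) ⁻¹' univ.pi s
      = (univ.pi fun j : Fin t => s j.castSucc) ×ˢ s (Fin.last t) := by
    ext p
    simp only [mem_preimage, mem_univ_pi, mem_prod]
    rw [Fin.forall_fin_succ']
    simp
  rw [this, Measure.prod_prod, Measure.pi_pi, Fin.prod_univ_castSucc]

/-- When the oracle ignores its queries, the replies are i.i.d. and independent of the seed. -/
lemma Protocol.law_const {d T : ℕ} {X : Set (Vec d)} (π : Protocol X T) (N : Measure (Vec d))
    [IsProbabilityMeasure N] (t : ℕ) :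
    π.law (Kernel.const X N) t = π.seedLaw.prod (Measure.pi fun _ : Fin t => N) := by
  induction t with
  | zero =>
    rw [Protocol.law, Measure.pi_of_empty _ Fin.elim0, Measure.prod_dirac]
  | succ t ih =>
    have hc : (Kernel.const X N).comap (π.query t) (π.measurable_query t)
        = Kernel.const _ N := by
      ext; simp
    rw [Protocol.law, ih, hc, Measure.compProd_const, ← map_snoc_pi_prod N t]
    have hs := measurable_snoc (α := Vec d) t
    conv_rhs => rw [← Measure.map_id (μ := π.seedLaw)]
    rw [Measure.map_prod_map _ _ measurable_id hs, ← Measure.prodAssoc_prod,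
      Measure.map_map (measurable_id.prodMap hs) (MeasurableEquiv.measurable _)]
    rfl

/-- Fubini for replies `A (seed, sign vector)`: it isolates the quantizer seeds, so that a finite
sum over sign transcripts remains for each fixed choice of seeds. -/
lemma lintegral_pi_map_prod {S C α : Type*} [MeasurableSpace S] [MeasurableSpace C]
    [MeasurableSpace α] [Fintype C] [MeasurableSingletonClass C] (ρ : Measure S)
    [IsProbabilityMeasure ρ] (μ : Measure C) [IsProbabilityMeasure μ] {A : S × C → α}
    (hA : Measurable A) (T : ℕ) {h : (Fin T → α) → ℝ≥0∞} (hh : Measurable h) :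
    ∫⁻ y, h y ∂(Measure.pi fun _ : Fin T => (ρ.prod μ).map A)
      = ∫⁻ s, ∑ G : Fin T → C, h (fun t => A (s t, G t)) * ∏ t, μ {G t}
        ∂(Measure.pi fun _ : Fin T => ρ) := by
  have := Measure.isProbabilityMeasure_map (μ := ρ.prod μ) hA.aemeasurable
  have hA' : Measurable fun (x : Fin T → S × C) t => A (x t) := by fun_prop
  rw [← Measure.pi_map_pi fun _ => hA.aemeasurable, lintegral_map hh hA']
  have mp := (measurePreserving_arrowProdEquivProdArrow S C (Fin T) (fun _ => ρ)
    (fun _ => μ)).symm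
  rw [← mp.lintegral_comp (f := fun x => h fun t => A (x t)) (hh.comp hA'), lintegral_prod]
  · refine lintegral_congr fun s => ?_
    rw [lintegral_fintype]
    refine Finset.sum_congr rfl fun G _ => ?_
    rw [Measure.pi_singleton]
    rfl
  · exact ((hh.comp hA').comp mp.measurable).aemeasurable

/-! ### The hard instances: linear functions on a cube with sign oracles -/

variable {d : ℕ}

/-- The law of independent signs with `E[g i] = ε * v i`. -/
def signLaw (ε : ℝ) (v : Fin d → Bool) : Measure (Fin d → Bool) :=
  ∑ g, ENNReal.ofReal (wt ε v g) • Measure.dirac g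

lemma signLaw_singleton (ε : ℝ) (v g : Fin d → Bool) :
    signLaw ε v {g} = ENNReal.ofReal (wt ε v g) := by
  simp [signLaw, Measure.finsetSum_apply, Set.indicator_apply]

lemma isProbabilityMeasure_signLaw {ε : ℝ} (h0 : 0 ≤ ε) (h1 : ε ≤ 1 / 2) (v : Fin d → Bool) :
    IsProbabilityMeasure (signLaw ε v) := by
  constructor
  simp only [signLaw, Measure.finsetSum_apply, Measure.smul_apply, measure_univ, smul_eq_mul,
    mul_one]
  rw [← ENNReal.ofReal_sum_of_nonneg fun g _ => (wt_pos h0 h1 v g).le, sum_wt, ENNReal.ofReal_one]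

/-- The vector with entries `s * (±1)`. -/
def signVec (s : ℝ) (g : Fin d → Bool) : Vec d := WithLp.toLp 2 fun i => s * sgn (g i)

lemma norm_sq_signVec (s : ℝ) (g : Fin d → Bool) : ‖signVec s g‖ ^ 2 = d * s ^ 2 := by
  rw [EuclideanSpace.norm_sq_eq]
  simp [signVec, abs_sgn]

lemma measurable_signVec (s : ℝ) : Measurable (signVec (d := d) s) := measurable_of_finite _

/-- Mean of one coordinate. -/
lemma sum_wt_mul_sgn (ε : ℝ) (v : Fin d → Bool) (i : Fin d) :
    ∑ g, wt ε v g * sgn (g i) = ε * sgn (v i) := by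
  have := sum_wt_mul_prod ε v fun j c => if j = i then sgn c else 1
  simp only [Finset.prod_ite_eq', Finset.mem_univ, if_true] at this
  rw [this, Finset.prod_eq_single i]
  · simp [sgn]; ring
  · intro j _ hj
    cases v j <;> simp [sgn, hj] <;> ring
  · simp

lemma integral_signVec {ε : ℝ} (h0 : 0 ≤ ε) (h1 : ε ≤ 1 / 2) (s : ℝ) (v : Fin d → Bool) :
    ∫ g, g ∂((signLaw ε v).map (signVec s)) = signVec (s * ε) v := by
  have := isProbabilityMeasure_signLaw h0 h1 v
  rw [integral_map (measurable_signVec s).aemeasurable (by fun_prop), integral_fintype .of_finite]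
  ext i
  simp only [measureReal_def, signLaw_singleton, ENNReal.toReal_ofReal (wt_pos h0 h1 v _).le]
  rw [WithLp.ofLp_sum, Finset.sum_apply]
  simp only [signVec, PiLp.smul_apply, smul_eq_mul]
  rw [mul_assoc, ← sum_wt_mul_sgn, Finset.mul_sum]
  exact Finset.sum_congr rfl fun g _ => by ring

/-- The cube of half side `a`. -/
def cube (d : ℕ) (a : ℝ) : Set (Vec d) := {x | ∀ i, |x i| ≤ a}

/-- The half side is chosen so that the main diagonal of the cube has length exactly `D`. -/
lemma cube_mem_domains {D : ℝ} (hd : 1 ≤ d) (hD : 0 ≤ D) :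
    cube d (D / (2 * √d)) ∈ domains d D := by
  set a := D / (2 * √d) with ha
  have hd' : (0 : ℝ) < d := by exact_mod_cast hd
  have ha0 : 0 ≤ a := by positivity
  have hdiam : ∀ x ∈ cube d a, ∀ y ∈ cube d a, ‖x - y‖ ≤ D := fun x hx y hy => by
    refine (sq_le_sq₀ (norm_nonneg _) hD).1 ?_
    rw [EuclideanSpace.norm_sq_eq]
    calc ∑ i, ‖(x - y) i‖ ^ 2 ≤ ∑ _i : Fin d, (2 * a) ^ 2 := by
          refine Finset.sum_le_sum fun i _ => ?_
          refine pow_le_pow_left₀ (norm_nonneg _) ?_ 2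
          rw [PiLp.sub_apply, Real.norm_eq_abs]
          have := abs_sub (x i) (y i)
          have := hx i
          have := hy i
          linarith
      _ = D ^ 2 := by
          rw [Finset.sum_const, Finset.card_univ, Fintype.card_fin, nsmul_eq_mul, ha, mul_div_assoc',
            mul_div_mul_left _ _ two_ne_zero, div_pow, Real.sq_sqrt hd'.le]
          field_simp
  have h0 : (0 : Vec d) ∈ cube d a := fun i => by simpa using ha0
  refine ⟨⟨0, h0⟩, ?_, ?_, hdiam⟩
  · refine Metric.isCompact_of_isClosed_isBounded ?_ ?_
    · simp only [cube, ofPred_forall]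
      exact isClosed_iInter fun i => isClosed_le (by fun_prop) continuous_const
    · exact (Metric.isBounded_iff_subset_closedBall 0).2 ⟨D, fun x hx => by
        simpa using hdiam x hx 0 h0⟩
  · intro x hx y hy s t hs ht hst i
    simp only [PiLp.add_apply, PiLp.smul_apply, smul_eq_mul]
    calc |s * x i + t * y i| ≤ |s * x i| + |t * y i| := abs_add_le _ _
      _ = s * |x i| + t * |y i| := by rw [abs_mul, abs_mul, abs_of_nonneg hs, abs_of_nonneg ht]
      _ ≤ s * a + t * a := add_le_add (mul_le_mul_of_nonneg_left (hx i) hs)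
          (mul_le_mul_of_nonneg_left (hy i) ht)
      _ = a := by rw [← add_mul, hst, one_mul]

/-- The oracle that ignores the query and returns random signs, scaled by `s`. -/
def signOracle (X : Set (Vec d)) (ε s : ℝ) (v : Fin d → Bool) : Oracle X :=
  Kernel.const X ((signLaw ε v).map (signVec s))

/-- The mean of the oracle is the gradient of the linear function, hence a subgradient at every
query. All outputs have the same norm, so the almost sure bound is the single inequality `hs`. -/
lemma signOracle_mem {X : Set (Vec d)} (hX : Convex ℝ X) {ε s B : ℝ} (h0 : 0 ≤ ε)
    (h1 : ε ≤ 1 / 2) (hs : d * s ^ 2 ≤ B ^ 2) (v : Fin d → Bool) :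
    ((fun x => inner ℝ (signVec (s * ε) v) x, signOracle X ε s v) : (Vec d → ℝ) × Oracle X)
      ∈ asOracles X B := by
  have := isProbabilityMeasure_signLaw h0 h1 v
  have hm := measurable_signVec (d := d) s
  have := Measure.isProbabilityMeasure_map (μ := signLaw ε v) hm.aemeasurable
  refine ⟨⟨⟨hX, fun x _ y _ a b _ _ _ => ?_⟩, ?_, fun x => ⟨?_, ?_⟩⟩, fun x => ?_⟩
  · simp [inner_add_right, inner_smul_right]
  · unfold signOracle; infer_instance
  · simp only [signOracle, Kernel.const_apply]
    exact (integrable_map_measure (by fun_prop) hm.aemeasurable).2 .of_finite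
  · simp only [signOracle, Kernel.const_apply, integral_signVec h0 h1]
    intro y _
    simp [inner_sub_right]
  · simp only [signOracle, Kernel.const_apply]
    rw [ae_map_iff hm.aemeasurable (measurableSet_le (by fun_prop) measurable_const)]
    exact .of_forall fun g => by rw [norm_sq_signVec]; exact hs

/-- The error of a protocol for a quantized sign oracle, conditionally on all seeds. -/
lemma error_signOracle {T r : ℕ} {X : Set (Vec d)} (π : Protocol X T) (Q : Quantizer d r) {ε : ℝ}
    (h0 : 0 ≤ ε) (h1 : ε ≤ 1 / 2) (s : ℝ) (v : Fin d → Bool) {f : Vec d → ℝ} (hf : Measurable f) :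
    π.error f (Q.compose (signOracle X ε s v))
      = ∫⁻ p, ∑ G : Fin T → (Fin d → Bool),
          ENNReal.ofReal (f (π.output (p.1, fun t => Q.apply (p.2 t, signVec s (G t))))
            - ⨅ x : X, f x) * ENNReal.ofReal (∏ t, wt ε v (G t))
        ∂(π.seedLaw.prod (Measure.pi fun _ : Fin T => Q.seedLaw)) := by
  have := isProbabilityMeasure_signLaw h0 h1 v
  have hm := measurable_signVec (d := d) s
  have := Measure.isProbabilityMeasure_map (μ := signLaw ε v) hm.aemeasurable
  have hQ : Measurable Q.apply :=
    Q.measurable_dec.comp (measurable_fst.prodMk Q.measurable_enc)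
  have hA : Measurable fun q : Q.Seed × (Fin d → Bool) => Q.apply (q.1, signVec s q.2) := by
    fun_prop
  have := Measure.isProbabilityMeasure_map (μ := Q.seedLaw.prod (signLaw ε v)) hA.aemeasurable
  have : IsMarkovKernel (signOracle X ε s v) := by unfold signOracle; infer_instance
  -- Quantization with fresh seeds keeps the oracle independent of the query, so
  -- `Protocol.law_const` applies.
  have hc : Q.compose (signOracle X ε s v) = Kernel.const X
      ((Q.seedLaw.prod (signLaw ε v)).map fun q => Q.apply (q.1, signVec s q.2)) := by
    ext1 x
    rw [Quantizer.compose, Kernel.map_apply _ hQ, Kernel.prod_apply, signOracle, Kernel.const_apply,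
      Kernel.const_apply, Kernel.const_apply, ← Measure.map_id (μ := Q.seedLaw),
      Measure.map_prod_map _ _ measurable_id hm, Measure.map_map hQ (by fun_prop), Measure.map_id]
    rfl
  set c := ⨅ x : X, f x
  have hh : Measurable fun p : π.Seed × (Fin T → Vec d) =>
      ENNReal.ofReal (f (π.output p) - c) :=
    ENNReal.measurable_ofReal.comp
      ((hf.comp (measurable_subtype_coe.comp π.measurable_output)).sub_const _)
  rw [Protocol.error, hc, Protocol.law_const, lintegral_prod _ hh.aemeasurable, lintegral_prod]
  · refine lintegral_congr fun ω => ?_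
    rw [lintegral_pi_map_prod _ _ hA _ (h := fun y => ENNReal.ofReal (f (π.output (ω, y)) - c))
      (hh.comp measurable_prodMk_left)]
    refine lintegral_congr fun q => Finset.sum_congr rfl fun G _ => ?_
    simp only [signLaw_singleton]
    rw [ENNReal.ofReal_prod_of_nonneg fun t _ => (wt_pos h0 h1 v (G t)).le]
  · refine (Finset.measurable_sum _ fun G _ => ?_).aemeasurable
    refine Measurable.mul_const (hh.comp (f := fun p : π.Seed × (Fin T → Q.Seed) =>
      (p.1, fun t => Q.apply (p.2 t, signVec s (G t)))) (by fun_prop)) _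

/-! ### From correlation to optimization error -/

lemma inner_signVec (s : ℝ) (v : Fin d → Bool) (x : Vec d) :
    inner ℝ (signVec s v) x = s * ∑ i, sgn (v i) * x i := by
  rw [PiLp.inner_apply, Finset.mul_sum]
  refine Finset.sum_congr rfl fun i _ => ?_
  simp [signVec]
  ring

lemma sum_sgn_mul_le {a : ℝ} (v : Fin d → Bool) {x : Vec d} (hx : x ∈ cube d a) :
    ∑ i, sgn (v i) * x i ≤ d * a := by
  calc _ ≤ ∑ _i : Fin d, a := Finset.sum_le_sum fun i _ => by
        refine (le_abs_self _).trans ?_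
        rw [abs_mul, abs_sgn, one_mul]
        exact hx i
    _ = _ := by simp

/-- The excess of a linear function with sign coefficients over its minimum on the cube. -/
lemma le_inner_sub_iInf {a b : ℝ} (ha : 0 ≤ a) (hb : 0 ≤ b) (v : Fin d → Bool) (y : Vec d) :
    b * (d * a - ∑ i, sgn (v i) * y i)
      ≤ inner ℝ (signVec (-b) v) y - ⨅ x : cube d a, inner ℝ (signVec (-b) v) x.1 := by
  have hmem : signVec a v ∈ cube d a := fun i => by
    simp [signVec, abs_mul, abs_sgn, abs_of_nonneg ha]
  have hbdd : BddBelow (range fun x : cube d a => inner ℝ (signVec (-b) v) x.1) := by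
    refine ⟨-(b * (d * a)), ?_⟩
    rintro _ ⟨x, rfl⟩
    simp only [inner_signVec]
    have := mul_le_mul_of_nonneg_left (sum_sgn_mul_le v x.2) hb
    linarith
  have h := ciInf_le hbdd ⟨signVec a v, hmem⟩
  have e : inner ℝ (signVec (-b) v) (signVec a v) = -b * (d * a) := by
    rw [inner_signVec]
    congr 1
    have : ∀ i, sgn (v i) * signVec a v i = a := fun i => by
      simp only [signVec]
      rw [mul_left_comm, sgn_mul_self, mul_one]
    simp [this]
  simp only [e] at h
  rw [inner_signVec]
  linarith

/-- `S` dominates the average error over the `2 ^ d` sign vectors. The bound on this average holds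
pointwise in the seeds of protocol and quantizer, so randomization, shared or not, cannot beat it.
-/
lemma ofReal_le_of_error_le {T r : ℕ} {a b s ε : ℝ} (ha : 0 ≤ a) (hb : 0 ≤ b) (h0 : 0 < ε)
    (h1 : ε ≤ 1 / 2) (π : Protocol (cube d a) T) (Q : Quantizer d r) {S : ℝ≥0∞}
    (hS : ∀ v : Fin d → Bool, π.error (fun x => inner ℝ (signVec (-b) v) x)
      (Q.compose (signOracle (cube d a) ε s v)) ≤ S) :
    ENNReal.ofReal (b * (d * a - 8 * a * ε * √(d * (T * (min d r : ℕ))))) ≤ S := by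
  set c := b * (d * a - 8 * a * ε * √(d * (T * (min d r : ℕ)))) with hc
  have key : ENNReal.ofReal (2 ^ d * c) ≤ ∑ v : Fin d → Bool, π.error
      (fun x => inner ℝ (signVec (-b) v) x) (Q.compose (signOracle (cube d a) ε s v)) := by
    have hf : ∀ v : Fin d → Bool, Measurable fun x => inner ℝ (signVec (-b) v) x := fun v => by
      fun_prop
    have hQ : Measurable Q.apply :=
      Q.measurable_dec.comp (measurable_fst.prodMk Q.measurable_enc)
    simp_rw [fun v => error_signOracle π Q h0.le h1 s v (hf v)]
    rw [← lintegral_finsetSum]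
    · calc ENNReal.ofReal (2 ^ d * c)
          = ∫⁻ _p, ENNReal.ofReal (2 ^ d * c)
            ∂(π.seedLaw.prod (Measure.pi fun _ : Fin T => Q.seedLaw)) := by simp
        _ ≤ _ := lintegral_mono fun p => ?_
      -- With the seeds `p` fixed, the encoders are deterministic, one for each query, and the
      -- decoders are absorbed into the output map `F`.
      set e : Fin T → (Fin d → Bool) → (Fin r → Bool) := fun t g => Q.enc (p.2 t, signVec s g)
      set F : (Fin T → (Fin r → Bool)) → Vec d :=
        fun m => π.output (p.1, fun t => Q.dec (p.2 t, m t))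
      have hF : ∀ m, F m ∈ cube d a := fun m => Subtype.property _
      have hW : ∀ (v : Fin d → Bool) (G : Fin T → (Fin d → Bool)), 0 ≤ ∏ t, wt ε v (G t) :=
        fun v G => Finset.prod_nonneg fun t _ => (wt_pos h0.le h1 v (G t)).le
      have hE : ∀ (v : Fin d → Bool) m, 0 ≤ b * (d * a - ∑ i, sgn (v i) * F m i) := fun v m =>
        mul_nonneg hb (sub_nonneg.2 (sum_sgn_mul_le v (hF m)))
      have hsum := sum_correlation_le h0 h1 ha e (fun m i => F m i) hF
      have hone : ∀ v, ∑ x : Fin T → (Fin r → Bool), ∏ t, msg ε (e t) v (x t) = 1 := fun v => by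
        rw [← Fintype.prod_sum]; simp [sum_msg]
      calc ENNReal.ofReal (2 ^ d * c)
          ≤ ENNReal.ofReal (∑ v, ∑ G : Fin T → (Fin d → Bool),
            (∏ t, wt ε v (G t)) * (b * (d * a - ∑ i, sgn (v i) * F (fun t => e t (G t)) i))) := by
            refine ENNReal.ofReal_le_ofReal ?_
            simp_rw [fun v => sum_prod_wt_mul ε e v
              fun m => b * (d * a - ∑ i, sgn (v i) * F m i)]
            have : ∀ v, ∑ x, (∏ t, msg ε (e t) v (x t)) * (b * (d * a - ∑ i, sgn (v i) * F x i))
                = b * (d * a) - b * ∑ x, (∏ t, msg ε (e t) v (x t)) * ∑ i, sgn (v i) * F x i :=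
              fun v => by
                rw [← mul_one (b * (d * a)), ← hone v, Finset.mul_sum, Finset.mul_sum,
                  ← Finset.sum_sub_distrib]
                exact Finset.sum_congr rfl fun x _ => by ring
            simp_rw [this]
            rw [Finset.sum_sub_distrib, ← Finset.mul_sum _ _ b, Finset.sum_const, Finset.card_univ,
              Fintype.card_pi]
            simp only [Fintype.card_bool, Finset.prod_const, Finset.card_univ, Fintype.card_fin,
              nsmul_eq_mul]
            push_cast
            have := mul_le_mul_of_nonneg_left hsum hb
            rw [Finset.mul_sum] at this
            rw [hc]
            linarith
        _ = ∑ v, ∑ G : Fin T → (Fin d → Bool), ENNReal.ofReal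
            ((∏ t, wt ε v (G t)) * (b * (d * a - ∑ i, sgn (v i) * F (fun t => e t (G t)) i))) := by
            rw [ENNReal.ofReal_sum_of_nonneg fun v _ => Finset.sum_nonneg fun G _ =>
              mul_nonneg (hW v G) (hE v _)]
            exact Finset.sum_congr rfl fun v _ =>
              ENNReal.ofReal_sum_of_nonneg fun G _ => mul_nonneg (hW v G) (hE v _)
        _ ≤ _ := by
            refine Finset.sum_le_sum fun v _ => Finset.sum_le_sum fun G _ => ?_
            rw [mul_comm, ENNReal.ofReal_mul (hE v _)]
            exact mul_le_mul_left (ENNReal.ofReal_le_ofReal (le_inner_sub_iInf ha hb v _)) _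
    · intro v _
      refine Finset.measurable_sum _ fun G _ => Measurable.mul_const
        (ENNReal.measurable_ofReal.comp (((hf v).comp (measurable_subtype_coe.comp
          (π.measurable_output.comp ?_))).sub_const _)) _
      fun_prop
  have h2 : (2 : ℝ≥0∞) ^ d * ENNReal.ofReal c ≤ 2 ^ d * S := by
    calc (2 : ℝ≥0∞) ^ d * ENNReal.ofReal c = ENNReal.ofReal (2 ^ d * c) := by
          rw [ENNReal.ofReal_mul (p := 2 ^ d) (by positivity), ENNReal.ofReal_pow (by norm_num)]
          norm_num
      _ ≤ ∑ _v : Fin d → Bool, S := key.trans (Finset.sum_le_sum fun v _ => hS v)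
      _ = _ := by simp
  exact (ENNReal.mul_le_mul_iff_right (by simp) (by simp)).1 h2

lemma ofReal_le_iSup_error {T r : ℕ} {B a b s ε : ℝ} (ha : 0 ≤ a) (hb : 0 ≤ b)
    (h0 : 0 < ε) (h1 : ε ≤ 1 / 2) (hX : Convex ℝ (cube d a)) (hs : s * ε = -b)
    (hB : d * s ^ 2 ≤ B ^ 2) (π : Protocol (cube d a) T) (Q : Quantizer d r) :
    ENNReal.ofReal (b * (d * a - 8 * a * ε * √(d * (T * (min d r : ℕ)))))
      ≤ ⨆ p ∈ asOracles (cube d a) B, π.error p.1 (Q.compose p.2) := by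
  refine ofReal_le_of_error_le (s := s) ha hb h0 h1 π Q fun v => ?_
  have hmem := signOracle_mem (X := cube d a) hX h0.le h1 hB v
  have e : signVec (s * ε) v = signVec (-b) v := by rw [hs]
  have h := le_biSup (fun p : (Vec d → ℝ) × Oracle (cube d a) => π.error p.1 (Q.compose p.2)) hmem
  simp only [e] at h
  exact h

lemma ofReal_le_minmaxErrorAS_of_cube {T r : ℕ} {D B a b s ε : ℝ} (ha : 0 ≤ a) (hb : 0 ≤ b)
    (h0 : 0 < ε) (h1 : ε ≤ 1 / 2) (hX : cube d a ∈ domains d D) (hs : s * ε = -b)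
    (hB : d * s ^ 2 ≤ B ^ 2) :
    ENNReal.ofReal (b * (d * a - 8 * a * ε * √(d * (T * (min d r : ℕ)))))
      ≤ minmaxErrorAS d T r D B :=
  le_iSup₂_of_le (cube d a) hX <| le_iInf fun π => le_iInf fun Q =>
    ofReal_le_iSup_error ha hb h0 h1 hX.2.2.1 hs hB π Q

lemma ofReal_le_minmaxErrorAS {T r : ℕ} {D B ε : ℝ} (hd : 1 ≤ d) (hD : 0 ≤ D) (hB : 0 ≤ B)
    (h0 : 0 < ε) (h1 : ε ≤ 1 / 2) :
    ENNReal.ofReal (B * D * ε / 2 * (1 - 8 * ε * √(T * (min d r : ℕ) / d)))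
      ≤ minmaxErrorAS d T r D B := by
  have hd' : (0 : ℝ) < d := by exact_mod_cast hd
  set m : ℝ := ((min d r : ℕ) : ℝ)
  set a := D / (2 * √d) with ha
  -- This scale saturates the norm bound, `d * s ^ 2 = B ^ 2`; the minus sign places the minimizer
  -- at the vertex with signs `v`.
  set s := -(B / √d) with hs
  set b := B * ε / √d with hb
  have hX := cube_mem_domains hd hD
  have hsb : s * ε = -b := by rw [hs, hb]; ring
  have e : B * D * ε / 2 * (1 - 8 * ε * √(T * m / d)) = b * (d * a - 8 * a * ε * √(d * (T * m))) := by
    have e1 : √((d : ℝ) * (T * m)) = d * √(T * m / d) := by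
      have : (d : ℝ) * (T * m) = d ^ 2 * (T * m / d) := by field_simp
      rw [this, Real.sqrt_mul (sq_nonneg _), Real.sqrt_sq hd'.le]
    have hq : √(d : ℝ) ≠ 0 := (Real.sqrt_pos.2 hd').ne'
    have e2 : b * (d * a) = B * D * ε / 2 := by
      rw [hb, ha]
      field_simp
      rw [Real.sq_sqrt hd'.le]
    rw [e1, ← e2]
    ring
  rw [e]
  exact ofReal_le_minmaxErrorAS_of_cube (by positivity) (by positivity) h0 h1 hX hsb
    (by rw [hs, neg_sq, div_pow, Real.sq_sqrt hd'.le, mul_div_cancel₀ _ hd'.ne'])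

/-! ### Choice of the bias and the minmax bounds -/

lemma asOracles_subset_msOracles (X : Set (Vec d)) (B : ℝ) : asOracles X B ⊆ msOracles X B := by
  rintro ⟨f, O⟩ ⟨hO, hB⟩
  refine ⟨hO, fun x => ?_⟩
  have : IsMarkovKernel O := hO.2.1
  calc _ ≤ ∫⁻ _, ENNReal.ofReal (B ^ 2) ∂(O x) :=
        lintegral_mono_ae ((hB x).mono fun g hg => ENNReal.ofReal_le_ofReal hg)
    _ = _ := by simp

lemma minmaxErrorAS_le_minmaxErrorMS (d T r : ℕ) (D B : ℝ) :
    minmaxErrorAS d T r D B ≤ minmaxErrorMS d T r D B :=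
  iSup₂_mono fun X _ => iInf_mono fun _ => iInf_mono fun _ =>
    biSup_mono fun _ hp => asOracles_subset_msOracles X B hp

lemma minmaxErrorAS_ge_of_le {T r : ℕ} {D B : ℝ} (hd : 1 ≤ d) (hT : 1 ≤ T) (hr : 1 ≤ r)
    (hD : 0 ≤ D) (hB : 0 ≤ B) (h : d ≤ T * min d r) :
    ENNReal.ofReal (1 / 64 * D * B / √T * √((d : ℝ) / ((min d r : ℕ) : ℝ)))
      ≤ minmaxErrorAS d T r D B := by
  have hd' : (0 : ℝ) < d := by exact_mod_cast hd
  have hT' : (0 : ℝ) < T := by exact_mod_cast hT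
  have hm' : (0 : ℝ) < (min d r : ℕ) := by exact_mod_cast le_min hd hr
  have h' : (d : ℝ) ≤ T * (min d r : ℕ) := by exact_mod_cast h
  set m : ℝ := ((min d r : ℕ) : ℝ)
  have hρ1 : √(d / (T * m)) ≤ 1 :=
    Real.sqrt_le_one.2 ((div_le_one (by positivity)).2 h')
  have hρ0 : 0 < √(d / (T * m)) := by positivity
  have hρ : √(d / (T * m)) * √(T * m / d) = 1 := by
    rw [← Real.sqrt_mul (by positivity), div_mul_div_cancel₀ (by positivity), div_self hd'.ne',
      Real.sqrt_one]
  have hρ' : √(d / (T * m)) = √(d / m) / √T := by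
    rw [← Real.sqrt_div (by positivity), div_div, mul_comm m]
  -- This `ε` makes the subtracted term `1 / 2`, so half of `B * D * ε / 2` remains, whence `1 /
  -- 64`. The hypothesis `h` keeps `ε ≤ 1 / 16`.
  refine le_trans (ENNReal.ofReal_le_ofReal (le_of_eq ?_)) (ofReal_le_minmaxErrorAS (T := T)
    (r := r) hd hD hB (ε := 1 / 16 * √(d / (T * m))) (by positivity) (by linarith))
  have : 8 * (1 / 16 * √(d / (T * m))) * √(T * m / d) = 1 / 2 := by
    rw [mul_assoc, mul_assoc, hρ]; norm_num
  rw [this, hρ']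
  ring

lemma minmaxErrorAS_ge_of_lt {T r : ℕ} {D B : ℝ} (hd : 1 ≤ d) (hD : 0 ≤ D) (hB : 0 ≤ B)
    (h : T * min d r < d) :
    ENNReal.ofReal (1 / 64 * D * B) ≤ minmaxErrorAS d T r D B := by
  have hd' : (0 : ℝ) < d := by exact_mod_cast hd
  have h' : (T : ℝ) * (min d r : ℕ) ≤ d := by exact_mod_cast h.le
  -- With so few bits in total, the constant bias `1 / 16` already keeps the subtracted term at most
  -- `1 / 2`.
  refine le_trans (ENNReal.ofReal_le_ofReal ?_) (ofReal_le_minmaxErrorAS (T := T)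
    (r := r) hd hD hB (ε := 1 / 16) (by norm_num) (by norm_num))
  have : √(T * (min d r : ℕ) / d) ≤ 1 := Real.sqrt_le_one.2 ((div_le_one hd').2 h')
  nlinarith [mul_nonneg hB hD]

end QuantOpt

end

theorem theoremt :
    (∃ c : ℝ, 0 < c ∧
      ∀ (d T r : ℕ) (D B : ℝ), 1 ≤ d → 1 ≤ T → 1 ≤ r → 0 ≤ D → 0 ≤ B →
        (d ≤ T * min d r →
          ENNReal.ofReal (c * D * B / Real.sqrt T * Real.sqrt ((d : ℝ) / ((min d r : ℕ) : ℝ))) ≤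
            QuantOpt.minmaxErrorAS d T r D B) ∧
        (T * min d r < d →
          ENNReal.ofReal (c * D * B) ≤ QuantOpt.minmaxErrorAS d T r D B) ∧
        QuantOpt.minmaxErrorAS d T r D B ≤ QuantOpt.minmaxErrorMS d T r D B) ∧
    (∀ K : ℝ, 0 < K → ∃ κ : ℝ, 0 < κ ∧ ∃ T₀ : ℕ,
      ∀ (d T r : ℕ) (D B : ℝ), 1 ≤ d → 1 ≤ T → T₀ ≤ T → 1 ≤ r → 0 ≤ D → 0 ≤ B →
        (QuantOpt.minmaxErrorAS d T r D B < ENNReal.ofReal (K * D * B / Real.sqrt T) ∨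
          QuantOpt.minmaxErrorMS d T r D B < ENNReal.ofReal (K * D * B / Real.sqrt T)) →
        κ * d ≤ r) := by
  refine ⟨⟨1 / 64, by norm_num, fun d T r D B hd hT hr hD hB =>
    ⟨QuantOpt.minmaxErrorAS_ge_of_le hd hT hr hD hB, QuantOpt.minmaxErrorAS_ge_of_lt hd hD hB,
      QuantOpt.minmaxErrorAS_le_minmaxErrorMS d T r D B⟩⟩, fun K hK => ?_⟩
  -- Comparing the lower bound with the assumed rate gives `√(d / min d r) < 64 * K`, hence this
  -- `κ`. The threshold on `T` serves only to exclude the case `T * min d r < d`.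
  refine ⟨1 / (64 * K) ^ 2, by positivity, ⌈(64 * K) ^ 2⌉₊,
    fun d T r D B hd hT hT₀ hr hD hB h => ?_⟩
  have hT' : (0 : ℝ) < T := by exact_mod_cast hT
  have hd' : (0 : ℝ) < d := by exact_mod_cast hd
  have hm' : (0 : ℝ) < (min d r : ℕ) := by exact_mod_cast le_min hd hr
  have hlt : QuantOpt.minmaxErrorAS d T r D B < ENNReal.ofReal (K * D * B / √T) :=
    h.elim id (QuantOpt.minmaxErrorAS_le_minmaxErrorMS d T r D B).trans_lt
  -- If `D * B = 0`, the assumed rate is zero and nothing in `ℝ≥0∞` lies strictly below it.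
  have hDB : 0 < D * B := by
    by_contra hn
    have h0 : D * B = 0 := le_antisymm (not_lt.1 hn) (mul_nonneg hD hB)
    rw [mul_assoc, h0] at hlt
    simp at hlt
  have hsT : 0 < √(T : ℝ) := Real.sqrt_pos.2 hT'
  rcases le_or_gt d (T * min d r) with hc | hc
  · have h1 := (QuantOpt.minmaxErrorAS_ge_of_le hd hT hr hD hB hc).trans_lt hlt
    have h2 := lt_of_not_ge fun h' => h1.not_ge (ENNReal.ofReal_le_ofReal h')
    set q := √((d : ℝ) / ((min d r : ℕ) : ℝ)) with hq
    have h3 : D * B / √T * (1 / 64 * q) < D * B / √T * K := by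
      calc _ = 1 / 64 * D * B / √T * q := by ring
        _ < _ := h2
        _ = _ := by ring
    have h4 : q < 64 * K := by
      have := lt_of_mul_lt_mul_left h3 (by positivity)
      linarith
    have h5 : (d : ℝ) / ((min d r : ℕ) : ℝ) ≤ (64 * K) ^ 2 := by
      rw [← Real.sq_sqrt (x := (d : ℝ) / ((min d r : ℕ) : ℝ)) (by positivity)]
      exact pow_le_pow_left₀ (Real.sqrt_nonneg _) h4.le 2
    rw [div_le_iff₀ hm'] at h5
    have h6 : ((min d r : ℕ) : ℝ) ≤ r := by exact_mod_cast min_le_right d r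
    rw [one_div_mul_eq_div, div_le_iff₀ (by positivity), mul_comm (r : ℝ)]
    exact h5.trans (mul_le_mul_of_nonneg_left h6 (by positivity))
  · exfalso
    have h1 := (QuantOpt.minmaxErrorAS_ge_of_lt hd hD hB hc).trans_lt hlt
    have h2 := lt_of_not_ge fun h' => h1.not_ge (ENNReal.ofReal_le_ofReal h')
    rw [lt_div_iff₀ hsT] at h2
    -- From here on the rate `K * D * B / √T` is at most `D * B / 64`, the lower bound in this case.
    have h3 : 64 * K ≤ √T := Real.le_sqrt_of_sq_le (Nat.ceil_le.1 hT₀)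
    nlinarith [mul_le_mul_of_nonneg_left h3 hDB.le]
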